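/- For a finite simple graph $G$ let $t(G)$ be its number of triangles and let $\Delta_E$ be the maximum, over the edges $e$ of $G$, of the number of triangles of $G$ containing $e$ (with $\Delta_E=0$ if $G$ has no edge). For pairwise disjoint $A,B,C\subseteq V(G)$ let $t(A,B,C)$ be the number of triangles in the graph obtained from the subgraph of $G$ induced by $A\cup B\cup C$ by deleting all edges with both endpoints in $A$, or both in $B$, or both in $C$. **Lemma (Sparsification for Tripartite Graphs).** There is an absolute constant $\kappa_2>0$ such that the following holds for all integers $k\ge 1$ and $d\ge 0$. Let $G$ be a graph on $n$ vertices with $\Delta_E\le d$, and let $A,B,C$ be pairwise disjoint subsets of $V(G)$. Let $A_1,\dots,A_k$, $B_1,\dots,B_k$ and $C_1,\dots,C_k$ be random partitions (parts may be empty) of $A$, $B$ and $C$, respectively, obtained by placing each element of $A$, $B$ and $C$, independently and uniformly at random, into one of the $k$ parts of its set. Then $$\mathbb{P}\left(\left|k^2\sum_{i=1}^k t(A_i,B_i,C_i)-t(A,B,C)\right|>\kappa_2\,d\,k^2\sqrt{t(G)}\,\log n\right)\le\frac{1}{n^8}.$$ -/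

import Mathlib

open MeasureTheory ProbabilityTheory

namespace TriangleSparsification

/-- `t(G)`: the number of triangles (three-element cliques) of `G`. -/
noncomputable def triangleCount {V : Type*} (G : SimpleGraph V) : ℕ :=
  (G.cliqueSet 3).ncard

/-- `Δ_e`: the number of triangles of `G` that have both endpoints of `e` among their vertices;
for an edge `e` of `G` these are the triangles having `e` as one of their edges. -/
noncomputable def trianglesOnEdge {V : Type*} (G : SimpleGraph V) (e : Sym2 V) : ℕ :=
  {T : Finset V | T ∈ G.cliqueSet 3 ∧ ∀ v ∈ e, v ∈ T}.ncard

/-- `Δ_E`: the maximum of `Δ_e` over all edges `e` of `G` (it is `0` when `G` has no edge). -/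
noncomputable def maxTrianglesOnEdge {V : Type*} (G : SimpleGraph V) : ℕ :=
  ⨆ e : G.edgeSet, trianglesOnEdge G e

/-- The tripartite subgraph `G(A, B, C)`: the subgraph of `G` induced by `A ∪ B ∪ C`, minus the
edges with both endpoints in `A`, or both in `B`, or both in `C`. It is kept on the vertex type `V`,
the vertices outside `A ∪ B ∪ C` being isolated, which does not affect its triangles. -/
def tripartiteSubgraph {V : Type*} (G : SimpleGraph V) (A B C : Finset V) : SimpleGraph V where
  Adj u v := G.Adj u v ∧ (u ∈ A ∨ u ∈ B ∨ u ∈ C) ∧ (v ∈ A ∨ v ∈ B ∨ v ∈ C) ∧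
    ¬ (u ∈ A ∧ v ∈ A) ∧ ¬ (u ∈ B ∧ v ∈ B) ∧ ¬ (u ∈ C ∧ v ∈ C)
  symm := ⟨fun _ _ h => ⟨h.1.symm, h.2.2.1, h.2.1, fun k => h.2.2.2.1 k.symm,
    fun k => h.2.2.2.2.1 k.symm, fun k => h.2.2.2.2.2 k.symm⟩⟩
  loopless := ⟨fun _ h => h.1.ne rfl⟩

/-- `t(A, B, C)`: the number of triangles of `G(A, B, C)`. -/
noncomputable def tripartiteTriangleCount {V : Type*} (G : SimpleGraph V) (A B C : Finset V) : ℕ :=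
  triangleCount (tripartiteSubgraph G A B C)

/-- The `i`-th part `S_i` of the partition of `S` given by an assignment `χ` of the elements of `S`
to the `k` parts. -/
def part {V : Type*} {S : Finset V} {k : ℕ} (χ : S → Fin k) (i : Fin k) : Finset V :=
  (Finset.univ.filter fun v : S => χ v = i).map (Function.Embedding.subtype _)

/-- The law of a uniformly random partition of `S` into `k` (possibly empty) parts: each element
of `S` is put into one of the `k` parts independently and uniformly at random. -/
noncomputable def uniformPartition {V : Type*} (S : Finset V) (k : ℕ) : Measure (S → Fin k) :=
  Measure.pi fun _ => uniformOn Set.univ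

end TriangleSparsification

namespace TriangleSparsification

/-! Let X be the number of crossing triangles with all three vertices of one colour (`monoWeight`).
Its mean is T/k², where T = t(A,B,C), and √(dT) ≤ d√t(G) when d ≥ 1, so it suffices that |X - T/k²|
is of order √(dT) log n.

The colours are exposed one class at a time. Given α and β, X is a sum over c of independent terms
f(c, γ c), where f(c, i) counts the i-coloured pairs in the link of c. Hoeffding's inequality pays
only for how much f(c, i) varies with i, and this is little: as codegrees are at most d, each f(c,
i) is likely to lie within 2√(d m_c q) of m_c/k², where m_c is the number of triangles at c
(`colorWeight_concentration`). The squared ranges then sum to order dTq, and X stays within order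
q√(dT) of its conditional mean Y/k (`hoeffding_of_concentrated`). Here Y counts the triangles whose
vertices in A and B agree in colour, and the same argument over A brings Y close to T/k.
`monoWeight_concentration` combines the two.

The union bound over vertices and colours costs a factor of order nk, affordable for k < n^10. For
larger k, X = 0 with probability at least 1 - n^(-8) (`monoWeight_ne_zero_le`), and then the
deviation T ≤ n³ is below k². -/

/-- The law of a uniformly random assignment of the elements of `S` to `k` parts. -/
noncomputable abbrev uniformColoring (S : Type*) [Fintype S] (k : ℕ) : Measure (S → Fin k) :=
  Measure.pi fun _ => uniformOn Set.univ

instance isProbabilityMeasure_uniformOn_fin (k : ℕ) [NeZero k] :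
    IsProbabilityMeasure (uniformOn (Set.univ : Set (Fin k))) :=
  isProbabilityMeasure_uniformOn Set.finite_univ Set.univ_nonempty

lemma uniformOn_fin_real_singleton (k : ℕ) (i : Fin k) :
    (uniformOn (Set.univ : Set (Fin k))).real {i} = 1 / k := by
  rw [measureReal_def, uniformOn_univ]
  simp

lemma integral_uniformOn_fin (k : ℕ) [NeZero k] (f : Fin k → ℝ) :
    ∫ i, f i ∂(uniformOn Set.univ) = (∑ i, f i) / k := by
  rw [integral_fintype (Integrable.of_finite), Finset.sum_div]
  refine Finset.sum_congr rfl fun i _ => ?_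
  rw [uniformOn_fin_real_singleton, smul_eq_mul]
  ring

lemma uniformColoring_real_eval_eq {S : Type*} [Fintype S] (k : ℕ) [NeZero k] (x : S) (i : Fin k) :
    (uniformColoring S k).real {ω | ω x = i} = 1 / k := by
  have h := (measurePreserving_eval (fun _ : S => uniformOn (Set.univ : Set (Fin k))) x)
  have h2 := h.measureReal_preimage (s := {i}) (MeasurableSet.singleton i).nullMeasurableSet
  rw [← uniformOn_fin_real_singleton k i, ← h2]
  rfl

/-! ### Hoeffding's inequality for independent uniform colours -/

section Hoeffding

variable {S : Type*} [Fintype S] {k : ℕ} [NeZero k]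

lemma hoeffding_upper (F : S → Fin k → ℝ) (l R : S → ℝ)
    (hF : ∀ x i, F x i ∈ Set.Icc (l x) (l x + R x)) {V ε : ℝ} (hV : ∑ x, R x ^ 2 ≤ V)
    (hpos : 0 < ∑ x, R x ^ 2) (hε : 0 ≤ ε) :
    (uniformColoring S k).real {ω | ε ≤ ∑ x, (F x (ω x) - (∑ i, F x i) / k)} ≤
      Real.exp (-2 * (ε ^ 2 / V)) := by
  have hind : iIndepFun (fun x (ω : S → Fin k) => F x (ω x) - (∑ i, F x i) / k)
      (uniformColoring S k) :=
    iIndepFun_pi (X := fun x j => F x j - (∑ i, F x i) / k)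
      fun x => (measurable_of_finite _).aemeasurable
  have hsub : ∀ x ∈ Finset.univ,
      HasSubgaussianMGF (fun ω : S → Fin k => F x (ω x) - (∑ i, F x i) / k)
        ((‖(l x + R x) - l x‖₊ / 2) ^ 2) (uniformColoring S k) := by
    intro x _
    have hmap : (uniformColoring S k).map (fun ω => ω x) = uniformOn Set.univ :=
      (measurePreserving_eval (fun _ : S => uniformOn (Set.univ : Set (Fin k))) x).map_eq
    have h := hasSubgaussianMGF_of_mem_Icc (μ := uniformOn (Set.univ : Set (Fin k)))
      (X := F x) (measurable_of_finite _).aemeasurable (Filter.Eventually.of_forall (hF x))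
    rw [integral_uniformOn_fin, ← hmap] at h
    have hmeas : AEMeasurable (fun ω : S → Fin k => ω x) (uniformColoring S k) :=
      (measurable_pi_apply x).aemeasurable
    exact HasSubgaussianMGF.of_map hmeas h
  refine (HasSubgaussianMGF.measure_sum_ge_le_of_iIndepFun hind hsub hε).trans ?_
  -- By Hoeffding's lemma a variable of range R has variance proxy (R/2)².
  have hc : ((∑ x, (‖(l x + R x) - l x‖₊ / 2) ^ 2 : NNReal) : ℝ) = (∑ x, R x ^ 2) / 4 := by
    rw [Finset.sum_div]
    push_cast
    refine Finset.sum_congr rfl fun x _ => ?_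
    rw [add_sub_cancel_left, div_pow, Real.norm_eq_abs, sq_abs]
    norm_num
  rw [hc]
  refine Real.exp_le_exp.2 ?_
  have h1 : ε ^ 2 / V ≤ ε ^ 2 / ∑ x, R x ^ 2 := by gcongr
  have h2 : -ε ^ 2 / (2 * ((∑ x, R x ^ 2) / 4)) = -2 * (ε ^ 2 / ∑ x, R x ^ 2) := by
    field_simp
    ring
  rw [h2]
  linarith

/-- Hoeffding's inequality for a sum of functions of independent uniform colours. -/
theorem hoeffding_uniformColoring (F : S → Fin k → ℝ) (l R : S → ℝ)
    (hF : ∀ x i, F x i ∈ Set.Icc (l x) (l x + R x)) {V q : ℝ} (hV : ∑ x, R x ^ 2 ≤ V)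
    (hq : 0 ≤ q) :
    (uniformColoring S k).real
      {ω | √(V * q) < |∑ x, F x (ω x) - (∑ x, ∑ i, F x i) / k|} ≤ 2 * Real.exp (-2 * q) := by
  have hk : (k : ℝ) ≠ 0 := Nat.cast_ne_zero.2 (NeZero.ne k)
  have hR : 0 ≤ ∑ x, R x ^ 2 := Finset.sum_nonneg fun x _ => sq_nonneg _
  have hV0 : 0 ≤ V := hR.trans hV
  have hdev : ∀ ω : S → Fin k, ∑ x, F x (ω x) - (∑ x, ∑ i, F x i) / k =
      ∑ x, (F x (ω x) - (∑ i, F x i) / k) := fun ω => by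
    rw [Finset.sum_sub_distrib, Finset.sum_div]
  rcases hR.eq_or_lt with h0 | hpos
  -- All ranges vanish, so the sum is constant and the strict inequality defining the event fails.
  · have hR0 : ∀ x, R x = 0 := fun x => by
      have := (Finset.sum_eq_zero_iff_of_nonneg (s := Finset.univ)
        (fun x _ => sq_nonneg (R x))).1 h0.symm x (Finset.mem_univ x)
      exact pow_eq_zero_iff two_ne_zero |>.1 this
    have hFl : ∀ x i, F x i = l x := fun x i => by
      have := hF x i
      rw [hR0, add_zero, Set.Icc_self] at this
      exact this
    have hempty : {ω : S → Fin k | √(V * q) < |∑ x, F x (ω x) - (∑ x, ∑ i, F x i) / k|} = ∅ := by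
      ext ω
      have : ∑ x, F x (ω x) - (∑ x, ∑ i, F x i) / k = 0 := by
        rw [hdev]
        refine Finset.sum_eq_zero fun x _ => ?_
        simp only [hFl, Finset.sum_const, Finset.card_univ, Fintype.card_fin, nsmul_eq_mul]
        field_simp
        ring
      simp [this, Real.sqrt_nonneg]
    rw [hempty, measureReal_empty]
    positivity
  · have hVpos : 0 < V := hpos.trans_le hV
    have hs : √(V * q) ^ 2 / V = q := by
      rw [Real.sq_sqrt (by positivity)]
      field_simp
    have h1 := hoeffding_upper F l R hF hV hpos (Real.sqrt_nonneg (V * q))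
    have h2 := hoeffding_upper (fun x i => -F x i) (fun x => -(l x + R x)) R
      (fun x i => ⟨neg_le_neg (hF x i).2, by linarith [(hF x i).1]⟩) hV hpos
      (Real.sqrt_nonneg (V * q))
    rw [hs] at h1 h2
    have hsub : {ω : S → Fin k | √(V * q) < |∑ x, F x (ω x) - (∑ x, ∑ i, F x i) / k|} ⊆
        {ω | √(V * q) ≤ ∑ x, (F x (ω x) - (∑ i, F x i) / k)} ∪
        {ω | √(V * q) ≤ ∑ x, (-F x (ω x) - (∑ i, -F x i) / k)} := by
      intro ω hω
      rw [Set.mem_ofPred_eq, hdev, lt_abs] at hω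
      refine hω.imp (fun h => h.le) fun h => ?_
      rw [Set.mem_ofPred_eq]
      refine h.le.trans_eq ?_
      rw [← Finset.sum_neg_distrib]
      refine Finset.sum_congr rfl fun x _ => ?_
      rw [Finset.sum_neg_distrib]
      ring
    calc _ ≤ _ := measureReal_mono hsub
      _ ≤ _ := measureReal_union_le _ _
      _ ≤ _ := by linarith

/-- Hoeffding's inequality for the weight of the elements of a given colour. -/
theorem hoeffding_weight_color (h : S → ℝ) (h0 : ∀ x, 0 ≤ h x) {V q : ℝ}
    (hV : ∑ x, h x ^ 2 ≤ V) (hq : 0 ≤ q) (i : Fin k) :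
    (uniformColoring S k).real
      {ω | √(V * q) < |(∑ x, if ω x = i then h x else 0) - (∑ x, h x) / k|} ≤
      2 * Real.exp (-2 * q) := by
  have := hoeffding_uniformColoring (S := S) (k := k) (fun x j => if j = i then h x else 0)
    0 h (fun x j => by
      constructor <;> split_ifs <;> simp [h0]) hV hq
  simpa using this

end Hoeffding

/-! ### Bounding probabilities by conditioning on the other coordinates -/

section Slices

variable {X Y Z : Type*} [MeasurableSpace X] [MeasurableSpace Y] [MeasurableSpace Z]
  {μ : Measure X} {ν : Measure Y} {ρ : Measure Z} [IsProbabilityMeasure μ]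
  [IsProbabilityMeasure ν] [IsProbabilityMeasure ρ]

lemma prod_real_le_of_forall_fst {s : Set (X × Y)} (hs : MeasurableSet s) {p : ℝ} (hp : 0 ≤ p)
    (h : ∀ x, ν.real {y | (x, y) ∈ s} ≤ p) : (μ.prod ν).real s ≤ p := by
  refine ENNReal.toReal_le_of_le_ofReal hp ?_
  rw [Measure.prod_apply hs]
  calc _ ≤ ∫⁻ _, ENNReal.ofReal p ∂μ := lintegral_mono fun x => by
        rw [← ofReal_measureReal]
        exact ENNReal.ofReal_le_ofReal (h x)
    _ = ENNReal.ofReal p := by simp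

lemma prod_real_le_of_forall_snd {s : Set (X × Y)} (hs : MeasurableSet s) {p : ℝ} (hp : 0 ≤ p)
    (h : ∀ y, μ.real {x | (x, y) ∈ s} ≤ p) : (μ.prod ν).real s ≤ p := by
  refine ENNReal.toReal_le_of_le_ofReal hp ?_
  rw [Measure.prod_apply_symm hs]
  calc _ ≤ ∫⁻ _, ENNReal.ofReal p ∂ν := lintegral_mono fun y => by
        rw [← ofReal_measureReal]
        exact ENNReal.ofReal_le_ofReal (h y)
    _ = ENNReal.ofReal p := by simp

variable [Finite X] [Finite Y] [Finite Z] [MeasurableSingletonClass X] [MeasurableSingletonClass Y]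
  [MeasurableSingletonClass Z] {P : X → Y → Z → Prop} {p : ℝ}

lemma prod_real_le_of_first (hp : 0 ≤ p) (h : ∀ y z, μ.real {x | P x y z} ≤ p) :
    (μ.prod (ν.prod ρ)).real {ω | P ω.1 ω.2.1 ω.2.2} ≤ p :=
  prod_real_le_of_forall_snd (Set.toFinite _).measurableSet hp fun y => h y.1 y.2

lemma prod_real_le_of_second (hp : 0 ≤ p) (h : ∀ x z, ν.real {y | P x y z} ≤ p) :
    (μ.prod (ν.prod ρ)).real {ω | P ω.1 ω.2.1 ω.2.2} ≤ p :=
  prod_real_le_of_forall_fst (Set.toFinite _).measurableSet hp fun x =>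
    prod_real_le_of_forall_snd (Set.toFinite _).measurableSet hp fun z => h x z

lemma prod_real_le_of_third (hp : 0 ≤ p) (h : ∀ x y, ρ.real {z | P x y z} ≤ p) :
    (μ.prod (ν.prod ρ)).real {ω | P ω.1 ω.2.1 ω.2.2} ≤ p :=
  prod_real_le_of_forall_fst (Set.toFinite _).measurableSet hp fun x =>
    prod_real_le_of_forall_fst (Set.toFinite _).measurableSet hp fun y => h x y

end Slices

/-- Since h ≤ g ≤ d, each square is at most d·g. This is how the codegree bound d enters Hoeffding's
variance. -/
lemma sum_sq_le_mul_sum {S : Type*} [Fintype S] {h g : S → ℝ} {d : ℝ} (h0 : ∀ x, 0 ≤ h x)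
    (hg : ∀ x, h x ≤ g x) (hd : ∀ x, g x ≤ d) : ∑ x, h x ^ 2 ≤ d * ∑ x, g x := by
  rw [Finset.mul_sum]
  refine Finset.sum_le_sum fun x _ => ?_
  rw [sq]
  exact mul_le_mul ((hg x).trans (hd x)) (hg x) (h0 x) ((h0 x).trans ((hg x).trans (hd x)))

/-- Hoeffding's inequality for summands that concentrate, uniformly in the colour. -/
theorem hoeffding_of_concentrated {S : Type*} [Fintype S] {k : ℕ} [NeZero k]
    (F : S → Fin k → ℝ) (c m : S → ℝ) (hm : ∀ x, 0 ≤ m x) {d r q : ℝ} (hd : 0 ≤ d) (hr : 0 ≤ r)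
    (hq : 0 ≤ q) (hF : ∀ x i, |F x i - c x| ≤ r * √(d * m x * q)) :
    (uniformColoring S k).real
      {ω | 2 * r * q * √(d * ∑ x, m x) < |∑ x, F x (ω x) - (∑ x, ∑ i, F x i) / k|} ≤
      2 * Real.exp (-2 * q) := by
  have hsum : 0 ≤ ∑ x, m x := Finset.sum_nonneg fun x _ => hm x
  have hV : ∑ x, (2 * (r * √(d * m x * q))) ^ 2 ≤ (2 * r) ^ 2 * (d * ∑ x, m x) * q := by
    refine le_of_eq ?_
    rw [Finset.mul_sum, Finset.mul_sum, Finset.sum_mul]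
    refine Finset.sum_congr rfl fun x _ => ?_
    rw [← mul_assoc, mul_pow, Real.sq_sqrt (mul_nonneg (mul_nonneg hd (hm x)) hq)]
    ring
  have h := hoeffding_uniformColoring F (fun x => c x - r * √(d * m x * q)) _
    (fun x i => by
      have := abs_le.1 (hF x i)
      exact ⟨by linarith, by linarith⟩) hV hq
  have hs : √((2 * r) ^ 2 * (d * ∑ x, m x) * q * q) = 2 * r * q * √(d * ∑ x, m x) := by
    rw [show (2 * r) ^ 2 * (d * ∑ x, m x) * q * q = (2 * r * q) ^ 2 * (d * ∑ x, m x) by ring,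
      Real.sqrt_mul (sq_nonneg _), Real.sqrt_sq (by positivity)]
  rwa [hs] at h

/-! ### Concentration of the monochromatic weight -/

section Tripartite

variable {A B C : Type*} [Fintype A] [Fintype B] [Fintype C] {k : ℕ}

/-- The law of three independent uniformly random colourings. -/
noncomputable abbrev uniformColoring₃ (A B C : Type*) [Fintype A] [Fintype B] [Fintype C] (k : ℕ) :
    Measure ((A → Fin k) × (B → Fin k) × (C → Fin k)) :=
  (uniformColoring A k).prod ((uniformColoring B k).prod (uniformColoring C k))

/-- The weight of the pairs both of whose members have colour `i`. -/
noncomputable def colorWeight (h : A → B → ℝ) (α : A → Fin k) (β : B → Fin k) (i : Fin k) : ℝ :=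
  ∑ a, if α a = i then ∑ b, if β b = i then h a b else 0 else 0

/-- The weight of the monochromatic triples. -/
noncomputable def monoWeight (w : A → B → C → ℝ) (α : A → Fin k) (β : B → Fin k)
    (γ : C → Fin k) : ℝ :=
  ∑ c, colorWeight (fun a b => w a b c) α β (γ c)

variable [NeZero k] {d q : ℝ}

lemma colorWeight_concentration_left (h : A → B → ℝ) (h0 : ∀ a b, 0 ≤ h a b)
    (hrow : ∀ a, ∑ b, h a b ≤ d) (hq : 0 ≤ q) (β : B → Fin k) (i : Fin k) :
    (uniformColoring A k).real
      {α | √(d * (∑ a, ∑ b, h a b) * q) < |colorWeight h α β i -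
        (∑ b, if β b = i then ∑ a, h a b else 0) / k|} ≤ 2 * Real.exp (-2 * q) := by
  have hswap : (∑ b, if β b = i then ∑ a, h a b else 0) =
      ∑ a, ∑ b, if β b = i then h a b else 0 := by
    rw [Finset.sum_comm]
    refine Finset.sum_congr rfl fun b _ => ?_
    split_ifs <;> simp
  have hn : ∀ a b, 0 ≤ if β b = i then h a b else 0 := fun a b => by split_ifs <;> simp [h0]
  have hs : ∀ a, 0 ≤ ∑ b, if β b = i then h a b else 0 := fun a =>
    Finset.sum_nonneg fun b _ => hn a b
  rw [hswap]
  refine hoeffding_weight_color (fun a => ∑ b, if β b = i then h a b else 0) hs ?_ hq i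
  -- Comparing with the full row sums makes the variance bound independent of β.
  refine sum_sq_le_mul_sum hs (fun a => Finset.sum_le_sum fun b _ => ?_) hrow
  split_ifs <;> simp [h0]

lemma colorWeight_concentration_right (h : A → B → ℝ) (h0 : ∀ a b, 0 ≤ h a b)
    (hcol : ∀ b, ∑ a, h a b ≤ d) (hq : 0 ≤ q) (i : Fin k) :
    (uniformColoring B k).real
      {β | √(d * (∑ a, ∑ b, h a b) * q) < |(∑ b, if β b = i then ∑ a, h a b else 0) -
        (∑ a, ∑ b, h a b) / k|} ≤ 2 * Real.exp (-2 * q) := by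
  have hn : ∀ b, 0 ≤ ∑ a, h a b := fun b => Finset.sum_nonneg fun a _ => h0 a b
  rw [Finset.sum_comm]
  exact hoeffding_weight_color (fun b => ∑ a, h a b) hn
    (sum_sq_le_mul_sum hn (fun b => le_rfl) hcol) hq i

/-- Concentration of the weight of the pairs coloured `i`. -/
theorem colorWeight_concentration (h : A → B → ℝ) (h0 : ∀ a b, 0 ≤ h a b)
    (hrow : ∀ a, ∑ b, h a b ≤ d) (hcol : ∀ b, ∑ a, h a b ≤ d) (hq : 0 ≤ q) (i : Fin k) :
    (uniformColoring₃ A B C k).real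
      {χ | 2 * √(d * (∑ a, ∑ b, h a b) * q) <
        |colorWeight h χ.1 χ.2.1 i - (∑ a, ∑ b, h a b) / k ^ 2|} ≤ 4 * Real.exp (-2 * q) := by
  have hk : (1 : ℝ) ≤ k := Nat.one_le_cast.2 (NeZero.one_le)
  have hp : 0 ≤ 2 * Real.exp (-2 * q) := by positivity
  -- Given β, the mean over α is u β / k; then u itself concentrates about s / k.
  obtain ⟨u, hu⟩ : ∃ u : (B → Fin k) → ℝ,
      u = fun β => ∑ b, if β b = i then ∑ a, h a b else 0 := ⟨_, rfl⟩
  have hleft : ∀ β, (uniformColoring A k).real {α | √(d * (∑ a, ∑ b, h a b) * q) <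
      |colorWeight h α β i - u β / k|} ≤ 2 * Real.exp (-2 * q) := fun β => by
    rw [hu]
    exact colorWeight_concentration_left h h0 hrow hq β i
  have hright : (uniformColoring B k).real {β | √(d * (∑ a, ∑ b, h a b) * q) <
      |u β - (∑ a, ∑ b, h a b) / k|} ≤ 2 * Real.exp (-2 * q) := by
    rw [hu]
    exact colorWeight_concentration_right h h0 hcol hq i
  generalize ∑ a, ∑ b, h a b = s at hleft hright ⊢
  have h1 : (uniformColoring₃ A B C k).real
      {χ | √(d * s * q) < |colorWeight h χ.1 χ.2.1 i - u χ.2.1 / k|} ≤ 2 * Real.exp (-2 * q) :=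
    prod_real_le_of_first (P := fun (α : A → Fin k) (β : B → Fin k) (_ : C → Fin k) =>
      √(d * s * q) < |colorWeight h α β i - u β / k|) hp fun β _ => hleft β
  have h2 : (uniformColoring₃ A B C k).real
      {χ | √(d * s * q) < |u χ.2.1 - s / k|} ≤ 2 * Real.exp (-2 * q) :=
    prod_real_le_of_second (P := fun (_ : A → Fin k) (β : B → Fin k) (_ : C → Fin k) =>
      √(d * s * q) < |u β - s / k|) hp fun _ _ => hright
  have h12 : 2 * Real.exp (-2 * q) + 2 * Real.exp (-2 * q) = 4 * Real.exp (-2 * q) := by ring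
  rw [← h12]
  refine le_trans (measureReal_mono fun χ hχ => ?_)
    ((measureReal_union_le _ _).trans (add_le_add h1 h2))
  by_contra hcon
  rw [Set.mem_union, not_or] at hcon
  simp only [Set.mem_ofPred_eq, not_lt] at hcon hχ
  refine absurd hχ (not_lt.2 ?_)
  calc |colorWeight h χ.1 χ.2.1 i - s / k ^ 2|
      = |(colorWeight h χ.1 χ.2.1 i - u χ.2.1 / k) + (u χ.2.1 - s / k) / k| := by
        congr 1
        field_simp
        ring
    _ ≤ |colorWeight h χ.1 χ.2.1 i - u χ.2.1 / k| + |(u χ.2.1 - s / k) / k| := abs_add_le _ _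
    _ ≤ √(d * s * q) + √(d * s * q) := by
        refine add_le_add hcon.1 ?_
        rw [abs_div, Nat.abs_cast]
        exact (div_le_self (abs_nonneg _) hk).trans hcon.2
    _ = _ := by ring

/-- Concentration of the weight of the monochromatic triples. -/
theorem monoWeight_concentration (w : A → B → C → ℝ) (h0 : ∀ a b c, 0 ≤ w a b c) (hd : 0 ≤ d)
    (hA : ∀ b c, ∑ a, w a b c ≤ d) (hB : ∀ a c, ∑ b, w a b c ≤ d) (hC : ∀ a b, ∑ c, w a b c ≤ d)
    (hq : 0 ≤ q) :
    (uniformColoring₃ A B C k).real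
      {χ | 6 * q * √(d * ∑ a, ∑ b, ∑ c, w a b c) <
        |monoWeight w χ.1 χ.2.1 χ.2.2 - (∑ a, ∑ b, ∑ c, w a b c) / k ^ 2|} ≤
      (4 * (Fintype.card C * k) + 2 * (Fintype.card A * k) + 4) * Real.exp (-2 * q) := by
  have hk : (1 : ℝ) ≤ k := Nat.one_le_cast.2 (NeZero.one_le)
  set T := ∑ a, ∑ b, ∑ c, w a b c with hT
  set m : C → ℝ := fun c => ∑ a, ∑ b, w a b c with hm
  set t : A → ℝ := fun a => ∑ b, ∑ c, w a b c
  have hmT : ∑ c, m c = T := by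
    rw [hm, hT, Finset.sum_comm]
    refine Finset.sum_congr rfl fun a _ => Finset.sum_comm
  have hm0 : ∀ c, 0 ≤ m c := fun c =>
    Finset.sum_nonneg fun a _ => Finset.sum_nonneg fun b _ => h0 a b c
  have ht0 : ∀ a, 0 ≤ t a := fun a =>
    Finset.sum_nonneg fun b _ => Finset.sum_nonneg fun c _ => h0 a b c
  let f : (A → Fin k) → (B → Fin k) → C → Fin k → ℝ := fun α β c i =>
    colorWeight (fun a b => w a b c) α β i
  let g : (B → Fin k) → A → Fin k → ℝ := fun β a i =>
    ∑ b, if β b = i then ∑ c, w a b c else 0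
  have hg : ∀ β, ∑ a, ∑ i, g β a i = T := fun β => by
    refine Finset.sum_congr rfl fun a _ => ?_
    rw [Finset.sum_comm]
    simp
  -- Summing over the colour of c leaves only the condition that a and b agree, so the conditional
  -- mean over γ is Y / k.
  have hfg : ∀ α β, ∑ c, ∑ i, f α β c i = ∑ a, g β a (α a) := fun α β => by
    have : ∀ c, ∑ i, f α β c i = ∑ a, ∑ b, if β b = α a then w a b c else 0 := fun c => by
      simp only [f, colorWeight]
      rw [Finset.sum_comm]
      simp
    simp only [this, g]
    rw [Finset.sum_comm]
    refine Finset.sum_congr rfl fun a _ => ?_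
    rw [Finset.sum_comm]
    refine Finset.sum_congr rfl fun b _ => ?_
    split_ifs <;> simp
  let E1 : C × Fin k → Set ((A → Fin k) × (B → Fin k) × (C → Fin k)) := fun ci =>
    {χ | 2 * √(d * m ci.1 * q) < |f χ.1 χ.2.1 ci.1 ci.2 - m ci.1 / k ^ 2|}
  let E2 : A × Fin k → Set ((A → Fin k) × (B → Fin k) × (C → Fin k)) := fun ai =>
    {χ | √(d * t ai.1 * q) < |g χ.2.1 ai.1 ai.2 - t ai.1 / k|}
  -- The good event is part of the bad one: for fixed α, β either it fails and the slice is empty,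
  -- or Hoeffding's inequality applies.
  let P3 : (A → Fin k) → (B → Fin k) → (C → Fin k) → Prop := fun α β γ =>
    (∀ c i, |f α β c i - m c / k ^ 2| ≤ 2 * √(d * m c * q)) ∧
      2 * 2 * q * √(d * ∑ c, m c) < |∑ c, f α β c (γ c) - (∑ c, ∑ i, f α β c i) / k|
  let P4 : (A → Fin k) → (B → Fin k) → (C → Fin k) → Prop := fun α β _ =>
    (∀ a i, |g β a i - t a / k| ≤ 1 * √(d * t a * q)) ∧
      2 * 1 * q * √(d * ∑ a, t a) < |∑ a, g β a (α a) - (∑ a, ∑ i, g β a i) / k|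
  have h1 : (uniformColoring₃ A B C k).real (⋃ ci, E1 ci) ≤
      4 * (Fintype.card C * k) * Real.exp (-2 * q) := by
    refine (measureReal_iUnion_fintype_le _).trans ?_
    refine (Finset.sum_le_card_nsmul _ _ (4 * Real.exp (-2 * q)) fun ci _ => ?_).trans_eq ?_
    · exact colorWeight_concentration _ (fun a b => h0 a b ci.1) (fun a => hB a ci.1)
        (fun b => hA b ci.1) hq ci.2
    · simp
      ring
  have h2 : (uniformColoring₃ A B C k).real (⋃ ai, E2 ai) ≤
      2 * (Fintype.card A * k) * Real.exp (-2 * q) := by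
    refine (measureReal_iUnion_fintype_le _).trans ?_
    refine (Finset.sum_le_card_nsmul _ _ (2 * Real.exp (-2 * q)) fun ai _ => ?_).trans_eq ?_
    · refine prod_real_le_of_second (P := fun (_ : A → Fin k) (β : B → Fin k) (_ : C → Fin k) => √(d * t ai.1 * q) <
        |g β ai.1 ai.2 - t ai.1 / k|) (by positivity) fun _ _ => ?_
      have hn : ∀ b, 0 ≤ ∑ c, w ai.1 b c := fun b => Finset.sum_nonneg fun c _ => h0 _ b c
      exact hoeffding_weight_color (fun b => ∑ c, w ai.1 b c) hn
        (sum_sq_le_mul_sum hn (fun b => le_rfl) (hC ai.1)) hq ai.2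
    · simp
      ring
  have h3 : (uniformColoring₃ A B C k).real {χ | P3 χ.1 χ.2.1 χ.2.2} ≤ 2 * Real.exp (-2 * q) := by
    refine prod_real_le_of_third (by positivity) fun α β => ?_
    by_cases hgood : ∀ c i, |f α β c i - m c / k ^ 2| ≤ 2 * √(d * m c * q)
    · exact (measureReal_mono fun γ hγ => hγ.2).trans
        (hoeffding_of_concentrated (f α β) _ m hm0 hd zero_le_two hq hgood)
    · simp only [P3, hgood, false_and]
      simpa using (Real.exp_pos _).le
  have h4 : (uniformColoring₃ A B C k).real {χ | P4 χ.1 χ.2.1 χ.2.2} ≤ 2 * Real.exp (-2 * q) := by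
    refine prod_real_le_of_first (by positivity) fun β γ => ?_
    by_cases hgood : ∀ a i, |g β a i - t a / k| ≤ 1 * √(d * t a * q)
    · exact (measureReal_mono fun α hα => hα.2).trans
        (hoeffding_of_concentrated (g β) _ t ht0 hd zero_le_one hq hgood)
    · simp only [P4, hgood, false_and]
      simpa using (Real.exp_pos _).le
  refine (measureReal_mono (s₂ := ((⋃ ci, E1 ci) ∪ ⋃ ai, E2 ai) ∪
    ({χ | P3 χ.1 χ.2.1 χ.2.2} ∪ {χ | P4 χ.1 χ.2.1 χ.2.2})) fun χ hχ => ?_).trans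
    ((measureReal_union_le _ _).trans (add_le_add
      ((measureReal_union_le _ _).trans (add_le_add h1 h2))
      ((measureReal_union_le _ _).trans (add_le_add h3 h4)))) |>.trans_eq (by ring)
  by_contra hcon
  simp only [Set.mem_union, Set.mem_iUnion, not_or, not_exists, Prod.forall, E1, E2, P3, P4,
    Set.mem_ofPred_eq, not_lt, not_and, one_mul, mul_one] at hcon
  obtain ⟨⟨e1, e2⟩, e3, e4⟩ := hcon
  have e3 := e3 e1
  have e4 := e4 e2
  rw [hmT, hfg] at e3
  rw [hg, show ∑ a, t a = T from rfl] at e4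
  rw [Set.mem_ofPred_eq] at hχ
  refine absurd hχ (not_lt.2 ?_)
  set Y := ∑ a, g χ.2.1 a (χ.1 a)
  calc |monoWeight w χ.1 χ.2.1 χ.2.2 - T / k ^ 2|
      = |(monoWeight w χ.1 χ.2.1 χ.2.2 - Y / k) + (Y - T / k) / k| := by
        congr 1
        field_simp
        ring
    _ ≤ |monoWeight w χ.1 χ.2.1 χ.2.2 - Y / k| + |(Y - T / k) / k| := abs_add_le _ _
    -- The radii r = 2 for f and r = 1 for g give 4 + 2 = 6.
    _ ≤ 2 * 2 * q * √(d * T) + 2 * q * √(d * T) := by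
        refine add_le_add e3 ?_
        rw [abs_div, Nat.abs_cast]
        exact (div_le_self (abs_nonneg _) hk).trans e4
    _ = _ := by ring

/-- Few pairs of vertices are likely to receive the same colour. -/
theorem monoWeight_ne_zero_le (w : A → B → C → ℝ) :
    (uniformColoring₃ A B C k).real {χ | monoWeight w χ.1 χ.2.1 χ.2.2 ≠ 0} ≤
      Fintype.card A * Fintype.card B / k := by
  refine (measureReal_mono (s₂ := ⋃ ab : A × B, {χ | χ.1 ab.1 = χ.2.1 ab.2}) fun χ hχ => ?_).trans
    ((measureReal_iUnion_fintype_le _).trans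
      (Finset.sum_le_card_nsmul _ _ ((1 : ℝ) / k) fun ab _ => ?_)) |>.trans_eq ?_
  · by_contra hcon
    simp only [Set.mem_iUnion, not_exists, Prod.forall, Set.mem_ofPred_eq] at hcon
    refine hχ (Finset.sum_eq_zero fun c _ => Finset.sum_eq_zero fun a _ => ?_)
    split_ifs with ha
    · refine Finset.sum_eq_zero fun b _ => ?_
      rw [if_neg]
      exact fun hb => hcon a b (ha.trans hb.symm)
    · rfl
  · refine prod_real_le_of_first (P := fun (α : A → Fin k) (β : B → Fin k) (_ : C → Fin k) => α ab.1 = β ab.2) (by positivity) fun β _ => ?_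
    exact (uniformColoring_real_eval_eq k ab.1 (β ab.2)).le
  · simp
    ring

end Tripartite

/-! ### From triangle counts to weighted sums -/

section Triangles

variable {V : Type*} (G : SimpleGraph V)

open Classical in
/-- The indicator that `u`, `v`, `x` span a triangle. -/
noncomputable def triangleWeight (u v x : V) : ℝ :=
  if G.Adj u v ∧ G.Adj u x ∧ G.Adj v x then 1 else 0

lemma triangleWeight_nonneg (u v x : V) : 0 ≤ triangleWeight G u v x := by
  unfold triangleWeight
  split_ifs <;> simp

lemma triangleWeight_le_one (u v x : V) : triangleWeight G u v x ≤ 1 := by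
  unfold triangleWeight
  split_ifs <;> simp

lemma triangleWeight_swap_right (u v x : V) : triangleWeight G u x v = triangleWeight G u v x := by
  have h : (G.Adj u x ∧ G.Adj u v ∧ G.Adj x v) ↔ (G.Adj u v ∧ G.Adj u x ∧ G.Adj v x) := by
    rw [G.adj_comm x v]
    exact and_left_comm
  unfold triangleWeight
  split_ifs with h1 h2 h2
  · rfl
  · exact absurd (h.1 h1) h2
  · exact absurd (h.2 h2) h1
  · rfl

lemma triangleWeight_rotate (u v x : V) : triangleWeight G x u v = triangleWeight G u v x := by
  have h : (G.Adj x u ∧ G.Adj x v ∧ G.Adj u v) ↔ (G.Adj u v ∧ G.Adj u x ∧ G.Adj v x) := by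
    rw [G.adj_comm x u, G.adj_comm x v]
    tauto
  unfold triangleWeight
  split_ifs with h1 h2 h2
  · rfl
  · exact absurd (h.1 h1) h2
  · exact absurd (h.2 h2) h1
  · rfl

lemma coe_tripartite_cliqueSet [DecidableEq V] {A B C : Finset V} (hAB : Disjoint A B)
    (hAC : Disjoint A C) (hBC : Disjoint B C) :
    (tripartiteSubgraph G A B C).cliqueSet 3 =
      (fun p : V × V × V => ({p.1, p.2.1, p.2.2} : Finset V)) ''
        {p | (p.1 ∈ A ∧ p.2.1 ∈ B ∧ p.2.2 ∈ C) ∧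
          G.Adj p.1 p.2.1 ∧ G.Adj p.1 p.2.2 ∧ G.Adj p.2.1 p.2.2} := by
  have hAB' := Finset.disjoint_left.1 hAB
  have hAC' := Finset.disjoint_left.1 hAC
  have hBC' := Finset.disjoint_left.1 hBC
  ext T
  rw [SimpleGraph.mem_cliqueSet_iff, SimpleGraph.is3Clique_iff]
  constructor
  · rintro ⟨x, y, z, ⟨hxy, hx, hy, n1, n2, n3⟩, ⟨hxz, -, hz, n4, n5, n6⟩,
      ⟨hyz, -, -, n7, n8, n9⟩, rfl⟩
    simp only [Set.mem_image, Set.mem_ofPred_eq, Prod.exists]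
    rw [not_and] at n1 n2 n3 n4 n5 n6 n7 n8 n9
    rcases hx with hx | hx | hx <;> rcases hy with hy | hy | hy <;>
      first
      | exact absurd hy (n1 hx)
      | exact absurd hy (n2 hx)
      | exact absurd hy (n3 hx)
      | rcases hz with hz | hz | hz <;>
        first
        | exact absurd hz (n4 hx)
        | exact absurd hz (n5 hx)
        | exact absurd hz (n6 hx)
        | exact absurd hz (n7 hy)
        | exact absurd hz (n8 hy)
        | exact absurd hz (n9 hy)
        | exact ⟨x, y, z, ⟨⟨hx, hy, hz⟩, hxy, hxz, hyz⟩, rfl⟩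
        | exact ⟨x, z, y, ⟨⟨hx, hz, hy⟩, hxz, hxy, hyz.symm⟩, by grind⟩
        | exact ⟨y, x, z, ⟨⟨hy, hx, hz⟩, hxy.symm, hyz, hxz⟩, by grind⟩
        | exact ⟨y, z, x, ⟨⟨hy, hz, hx⟩, hyz, hxy.symm, hxz.symm⟩, by grind⟩
        | exact ⟨z, x, y, ⟨⟨hz, hx, hy⟩, hxz.symm, hyz.symm, hxy⟩, by grind⟩
        | exact ⟨z, y, x, ⟨⟨hz, hy, hx⟩, hyz.symm, hxz.symm, hxy.symm⟩, by grind⟩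
  · rintro ⟨⟨a, b, c⟩, ⟨⟨ha, hb, hc⟩, hab, hac, hbc⟩, rfl⟩
    dsimp only at ha hb hc hab hac hbc
    refine ⟨a, b, c, ?_, ?_, ?_, rfl⟩ <;> simp only [tripartiteSubgraph] <;> grind

/-- Disjointness of the three classes lets a triangle determine its ordered triple, so the image and
the set of triples have equal size. -/
lemma tripartiteTriangleCount_eq_sum {A B C : Finset V} (hAB : Disjoint A B)
    (hAC : Disjoint A C) (hBC : Disjoint B C) :
    (tripartiteTriangleCount G A B C : ℝ) =
      ∑ a ∈ A, ∑ b ∈ B, ∑ c ∈ C, triangleWeight G a b c := by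
  classical
  have hAB' := Finset.disjoint_left.1 hAB
  have hAC' := Finset.disjoint_left.1 hAC
  have hBC' := Finset.disjoint_left.1 hBC
  rw [tripartiteTriangleCount, triangleCount, coe_tripartite_cliqueSet G hAB hAC hBC,
    Set.InjOn.ncard_image]
  · have : {p : V × V × V | (p.1 ∈ A ∧ p.2.1 ∈ B ∧ p.2.2 ∈ C) ∧
        G.Adj p.1 p.2.1 ∧ G.Adj p.1 p.2.2 ∧ G.Adj p.2.1 p.2.2} =
        ((A ×ˢ B ×ˢ C).filter fun p =>
          G.Adj p.1 p.2.1 ∧ G.Adj p.1 p.2.2 ∧ G.Adj p.2.1 p.2.2 : Finset (V × V × V)) := by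
      ext p
      simp
    rw [this, Set.ncard_coe_finset, Finset.card_filter, Finset.sum_product]
    simp only [Finset.sum_product, triangleWeight]
    push_cast
    rfl
  · rintro ⟨a, b, c⟩ ⟨⟨ha, hb, hc⟩, -⟩ ⟨a', b', c'⟩ ⟨⟨ha', hb', hc'⟩, -⟩ h
    dsimp only at ha hb hc ha' hb' hc' h
    have h1 : a ∈ ({a', b', c'} : Finset V) := h ▸ by simp
    have h2 : b ∈ ({a', b', c'} : Finset V) := h ▸ by simp
    have h3 : c ∈ ({a', b', c'} : Finset V) := h ▸ by simp
    simp only [Finset.mem_insert, Finset.mem_singleton] at h1 h2 h3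
    grind

lemma mem_part {S : Finset V} {k : ℕ} {χ : S → Fin k} {i : Fin k} {v : V}
    (h : v ∈ part χ i) : v ∈ S := by
  obtain ⟨x, -, rfl⟩ := Finset.mem_map.1 h
  exact x.2

lemma sum_part {S : Finset V} {k : ℕ} (χ : S → Fin k) (i : Fin k) (f : V → ℝ) :
    ∑ v ∈ part χ i, f v = ∑ x : S, if χ x = i then f x else 0 := by
  rw [part, Finset.sum_map, Finset.sum_filter]
  rfl

lemma sum_tripartiteTriangleCount_part {A B C : Finset V} (hAB : Disjoint A B)
    (hAC : Disjoint A C) (hBC : Disjoint B C) {k : ℕ} (α : A → Fin k) (β : B → Fin k)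
    (γ : C → Fin k) :
    ∑ i, (tripartiteTriangleCount G (part α i) (part β i) (part γ i) : ℝ) =
      monoWeight (fun (a : A) (b : B) (c : C) => triangleWeight G a b c) α β γ := by
  have hdis : ∀ {S S' : Finset V} (σ : S → Fin k) (τ : S' → Fin k) (i : Fin k), Disjoint S S' →
      Disjoint (part σ i) (part τ i) := fun σ τ i h =>
    h.mono (fun _ hv => mem_part hv) (fun _ hv => mem_part hv)
  have hcount : ∀ i, (tripartiteTriangleCount G (part α i) (part β i) (part γ i) : ℝ) =
      ∑ c : C, if γ c = i then
        colorWeight (fun (a : A) (b : B) => triangleWeight G a b c) α β i else 0 := fun i => by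
    rw [tripartiteTriangleCount_eq_sum G (hdis α β i hAB) (hdis α γ i hAC) (hdis β γ i hBC)]
    rw [← sum_part γ i fun c => colorWeight (fun (a : A) (b : B) => triangleWeight G a b c) α β i]
    simp only [colorWeight, sum_part α i]
    rw [Finset.sum_comm]
    refine Finset.sum_congr rfl fun a _ => ?_
    split_ifs
    · rw [Finset.sum_comm]
      exact Finset.sum_congr rfl fun c _ => sum_part β i fun b => triangleWeight G a b c
    · simp
  simp only [hcount, monoWeight]
  rw [Finset.sum_comm]
  simp

variable [Finite V]

lemma tripartiteTriangleCount_le (A B C : Finset V) :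
    tripartiteTriangleCount G A B C ≤ triangleCount G :=
  Set.ncard_le_ncard (SimpleGraph.cliqueSet_mono fun _ _ h => h.1) (Set.toFinite _)

/-- If u and v are adjacent, x ↦ {u, v, x} injects the common neighbours into the triangles on uv;
otherwise every term is 0. -/
lemma sum_triangleWeight_le (S : Finset V) (u v : V) :
    ∑ x : S, triangleWeight G u v x ≤ maxTrianglesOnEdge G := by
  classical
  rw [Finset.sum_coe_sort S fun x => triangleWeight G u v x]
  by_cases huv : G.Adj u v
  · simp only [triangleWeight, Finset.sum_boole]
    refine Nat.cast_le.2 ?_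
    have hmax : trianglesOnEdge G s(u, v) ≤ maxTrianglesOnEdge G :=
      le_ciSup (f := fun e : G.edgeSet => trianglesOnEdge G e) (Set.finite_range _).bddAbove
        ⟨s(u, v), huv⟩
    refine le_trans ?_ hmax
    rw [← Set.ncard_coe_finset, ← Set.InjOn.ncard_image (f := fun x => ({u, v, x} : Finset V))]
    · refine Set.ncard_le_ncard ?_ (Set.toFinite _)
      rintro _ ⟨x, hx, rfl⟩
      have hx := (Finset.mem_filter.1 (Finset.mem_coe.1 hx)).2
      refine ⟨?_, ?_⟩
      · exact SimpleGraph.mem_cliqueSet_iff.2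
          (SimpleGraph.is3Clique_triple_iff.2 hx)
      · simp
    · intro x hx y hy hxy
      have hx := (Finset.mem_filter.1 (Finset.mem_coe.1 hx)).2
      have h1 : x ∈ ({u, v, y} : Finset V) := by
        dsimp only at hxy
        rw [← hxy]
        simp
      simp only [Finset.mem_insert, Finset.mem_singleton] at h1
      rcases h1 with h | h | h
      · exact absurd h hx.2.1.ne'
      · exact absurd h hx.2.2.ne'
      · exact h
  · simp [triangleWeight, huv]

end Triangles

end TriangleSparsification

/-! ### The sparsification lemma -/

open TriangleSparsification in
theorem mainTheorem3 :
    ∃ κ₂ : ℝ, 0 < κ₂ ∧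
      ∀ (k d : ℕ), 1 ≤ k →
      ∀ (V : Type*) [Fintype V] (G : SimpleGraph V),
        TriangleSparsification.maxTrianglesOnEdge G ≤ d →
      ∀ A B C : Finset V, Disjoint A B → Disjoint A C → Disjoint B C →
        ((TriangleSparsification.uniformPartition A k).prod
            ((TriangleSparsification.uniformPartition B k).prod
              (TriangleSparsification.uniformPartition C k))).real
          {χ : (A → Fin k) × (B → Fin k) × (C → Fin k) |
            |(k : ℝ) ^ 2 * ∑ i : Fin k,
                (TriangleSparsification.tripartiteTriangleCount G
                  (TriangleSparsification.part χ.1 i)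
                  (TriangleSparsification.part χ.2.1 i)
                  (TriangleSparsification.part χ.2.2 i) : ℝ)
              - (TriangleSparsification.tripartiteTriangleCount G A B C : ℝ)| >
            κ₂ * (d : ℝ) * (k : ℝ) ^ 2 *
              Real.sqrt (TriangleSparsification.triangleCount G : ℝ) *
              Real.log (Fintype.card V : ℝ)}
          ≤ 1 / (Fintype.card V : ℝ) ^ 8 := by
  refine ⟨66, by norm_num, fun k d hk V _ G hd A B C hAB hAC hBC => ?_⟩
  have : NeZero k := ⟨by omega⟩
  have hk1 : (1 : ℝ) ≤ k := Nat.one_le_cast.2 hk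
  simp only [sum_tripartiteTriangleCount_part G hAB hAC hBC]
  change (uniformColoring₃ A B C k).real _ ≤ _
  have hTt : (tripartiteTriangleCount G A B C : ℝ) ≤ triangleCount G :=
    Nat.cast_le.2 (tripartiteTriangleCount_le G A B C)
  have hTsum : (tripartiteTriangleCount G A B C : ℝ) =
      ∑ a : A, ∑ b : B, ∑ c : C, triangleWeight G a b c := by
    rw [tripartiteTriangleCount_eq_sum G hAB hAC hBC, ← Finset.sum_coe_sort A]
    refine Finset.sum_congr rfl fun a _ => ?_
    rw [← Finset.sum_coe_sort B]
    refine Finset.sum_congr rfl fun b _ => ?_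
    rw [← Finset.sum_coe_sort C]
  have hd' : (maxTrianglesOnEdge G : ℝ) ≤ d := Nat.cast_le.2 hd
  set w : A → B → C → ℝ := fun a b c => triangleWeight G a b c
  have h0 : ∀ a b c, 0 ≤ w a b c := fun a b c => triangleWeight_nonneg G a b c
  have h1 : ∀ a b c, w a b c ≤ 1 := fun a b c => triangleWeight_le_one G a b c
  have hC : ∀ a b, ∑ c, w a b c ≤ d := fun a b => (sum_triangleWeight_le G C a b).trans hd'
  have hB : ∀ a c, ∑ b, w a b c ≤ d := fun a c => by
    refine le_trans (le_of_eq ?_) ((sum_triangleWeight_le G B a c).trans hd')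
    exact Finset.sum_congr rfl fun b _ => triangleWeight_swap_right G a c b
  have hA : ∀ b c, ∑ a, w a b c ≤ d := fun b c => by
    refine le_trans (le_of_eq ?_) ((sum_triangleWeight_le G A b c).trans hd')
    exact Finset.sum_congr rfl fun a _ => triangleWeight_rotate G b c a
  have hT0 : 0 ≤ (tripartiteTriangleCount G A B C : ℝ) := Nat.cast_nonneg _
  rw [show ∑ a : A, ∑ b : B, ∑ c : C, triangleWeight G a b c =
    ∑ a, ∑ b, ∑ c, w a b c from rfl] at hTsum
  set n := Fintype.card V
  have hcard : ∀ S : Finset V, (Fintype.card S : ℝ) ≤ n := fun S => by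
    rw [Fintype.card_coe]
    exact Nat.cast_le.2 S.card_le_univ
  have hL0 : 0 ≤ Real.log n := Real.log_natCast_nonneg n
  -- Without crossing triangles the event is empty; this covers n = 0, where the bound reads 1/0 =
  -- 0. Otherwise n ≥ 3 and d, T, log n ≥ 1.
  by_cases hzero : ∀ a b c, w a b c = 0
  · have hempty : {χ : (A → Fin k) × (B → Fin k) × (C → Fin k) |
        |(k : ℝ) ^ 2 * monoWeight w χ.1 χ.2.1 χ.2.2 - (tripartiteTriangleCount G A B C : ℝ)| >
          66 * (d : ℝ) * (k : ℝ) ^ 2 * √(triangleCount G : ℝ) * Real.log n} = ∅ := by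
      refine Set.eq_empty_of_forall_notMem fun χ hχ => ?_
      rw [Set.mem_ofPred_eq] at hχ
      refine absurd hχ (not_lt.2 ?_)
      rw [hTsum]
      simp only [monoWeight, colorWeight, hzero]
      simp
      positivity
    rw [hempty, measureReal_empty]
    positivity
  push Not at hzero
  obtain ⟨a, b, c, habc⟩ := hzero
  have hadj : G.Adj a b ∧ G.Adj a c ∧ G.Adj b c := by
    by_contra h
    exact habc (if_neg h)
  have hw1 : w a b c = 1 := if_pos hadj
  have hd1 : (1 : ℝ) ≤ d := hw1.symm.le.trans
    ((Finset.single_le_sum (f := fun c => w a b c) (fun c _ => h0 a b c)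
      (Finset.mem_univ c)).trans (hC a b))
  have hT1 : (1 : ℝ) ≤ tripartiteTriangleCount G A B C := by
    rw [hTsum]
    calc (1 : ℝ) = w a b c := hw1.symm
      _ ≤ ∑ c, w a b c := Finset.single_le_sum (f := fun c => w a b c)
        (fun c _ => h0 a b c) (Finset.mem_univ c)
      _ ≤ ∑ b, ∑ c, w a b c := Finset.single_le_sum (f := fun b => ∑ c, w a b c)
        (fun b _ => Finset.sum_nonneg fun c _ => h0 a b c) (Finset.mem_univ b)
      _ ≤ ∑ a, ∑ b, ∑ c, w a b c := Finset.single_le_sum (f := fun a => ∑ b, ∑ c, w a b c)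
        (fun a _ => Finset.sum_nonneg fun b _ => Finset.sum_nonneg fun c _ => h0 a b c)
        (Finset.mem_univ a)
  have hn3 : (3 : ℝ) ≤ n := by
    classical
    have h3 := (SimpleGraph.is3Clique_triple_iff.2 hadj).card_eq
    exact_mod_cast h3 ▸ Finset.card_le_univ ({(a : V), (b : V), (c : V)} : Finset V)
  have hnpos : (0 : ℝ) < n := by linarith
  have hL1 : 1 ≤ Real.log n := by
    rw [Real.le_log_iff_exp_le hnpos]
    linarith [Real.exp_one_lt_d9]
  have hTn : (tripartiteTriangleCount G A B C : ℝ) ≤ n ^ 3 := by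
    rw [hTsum]
    calc ∑ a, ∑ b, ∑ c, w a b c ≤ ∑ a : A, ∑ b : B, ∑ c : C, (1 : ℝ) := by
          gcongr with a _ b _ c _
          exact h1 a b c
      _ = Fintype.card A * (Fintype.card B * Fintype.card C) := by simp
      _ ≤ n * (n * n) := mul_le_mul (hcard A) (mul_le_mul (hcard B) (hcard C) (by positivity)
          (by positivity)) (by positivity) (by positivity)
      _ = _ := by ring
  set T : ℝ := (tripartiteTriangleCount G A B C : ℝ)
  have hsqrt : √(d * T) ≤ d * √(triangleCount G : ℝ) := by
    rw [Real.sqrt_mul (by positivity)]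
    refine mul_le_mul ?_ (Real.sqrt_le_sqrt hTt) (Real.sqrt_nonneg _) (by positivity)
    exact Real.sqrt_le_self_iff.2 (Or.inr hd1)
  rcases lt_or_ge (k : ℝ) (n ^ 10) with hkn | hkn
  -- The choice q = 11 log n gives 66 = 6·11 and failure at most 10 n^11 · n^(-22) ≤ n^(-8), as 10 ≤
  -- n³.
  · have hmain := monoWeight_concentration (k := k) (q := 11 * Real.log n) w h0
      (Nat.cast_nonneg d) hA hB hC (by positivity)
    rw [← hTsum] at hmain
    have hexp : Real.exp (-2 * (11 * Real.log n)) = 1 / (n : ℝ) ^ 22 := by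
      rw [show -2 * (11 * Real.log n) = -(((22 : ℕ) : ℝ) * Real.log n) by push_cast; ring,
        Real.exp_neg, Real.exp_nat_mul, Real.exp_log hnpos, one_div]
    refine (measureReal_mono fun χ hχ => ?_).trans (hmain.trans ?_)
    · rw [Set.mem_ofPred_eq] at hχ ⊢
      set X := monoWeight w χ.1 χ.2.1 χ.2.2
      have hX : (k : ℝ) ^ 2 * X - T = k ^ 2 * (X - T / k ^ 2) := by
        field_simp
      rw [hX, abs_mul, abs_of_pos (by positivity : (0 : ℝ) < k ^ 2)] at hχ
      have h2 : (k : ℝ) ^ 2 * (6 * (11 * Real.log n) * √(d * T)) < k ^ 2 * |X - T / k ^ 2| := by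
        refine lt_of_le_of_lt ?_ hχ
        calc (k : ℝ) ^ 2 * (6 * (11 * Real.log n) * √(d * T))
            ≤ k ^ 2 * (6 * (11 * Real.log n) * (d * √(triangleCount G : ℝ))) := by gcongr
          _ = _ := by ring
      exact lt_of_mul_lt_mul_left h2 (by positivity)
    · rw [hexp]
      have hn1 : (1 : ℝ) ≤ n ^ 11 := one_le_pow₀ (by linarith)
      have hn33 : (10 : ℝ) ≤ n ^ 3 := by
        calc (10 : ℝ) ≤ 3 ^ 3 := by norm_num
          _ ≤ n ^ 3 := by gcongr
      calc (4 * (Fintype.card C * k) + 2 * (Fintype.card A * k) + 4 : ℝ) * (1 / (n : ℝ) ^ 22)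
          ≤ (4 * (n * n ^ 10) + 2 * (n * n ^ 10) + 4 * n ^ 11) * (1 / (n : ℝ) ^ 22) := by
            gcongr
            · exact Nat.cast_le.1 (hcard C)
            · exact Nat.cast_le.1 (hcard A)
            · linarith
        _ = 10 * (1 / (n : ℝ) ^ 11) := by
            field_simp
            ring
        _ ≤ n ^ 3 * (1 / (n : ℝ) ^ 11) := by gcongr
        _ = 1 / (n : ℝ) ^ 8 := by field_simp
  · refine (measureReal_mono fun χ hχ => ?_).trans ((monoWeight_ne_zero_le w).trans ?_)
    · intro hX
      rw [Set.mem_ofPred_eq, hX, mul_zero, zero_sub, abs_neg, abs_of_nonneg hT0] at hχ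
      refine absurd hχ (not_lt.2 ?_)
      have ht1 : 1 ≤ √(triangleCount G : ℝ) := Real.one_le_sqrt.2 (hT1.trans hTt)
      calc T ≤ n ^ 3 := hTn
        _ ≤ n ^ 10 := pow_le_pow_right₀ (by linarith) (by norm_num)
        _ ≤ k := hkn
        _ ≤ (k : ℝ) ^ 2 := le_self_pow₀ hk1 two_ne_zero
        _ = 1 * 1 * (k : ℝ) ^ 2 * 1 * 1 := by ring
        _ ≤ 66 * (d : ℝ) * (k : ℝ) ^ 2 * √(triangleCount G : ℝ) * Real.log n := by
          gcongr
          norm_num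
    · calc (Fintype.card A * Fintype.card B / k : ℝ) ≤ n * n / n ^ 10 := by
            gcongr
            · exact Nat.cast_le.1 (hcard A)
            · exact Nat.cast_le.1 (hcard B)
        _ = 1 / (n : ℝ) ^ 8 := by field_simp
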